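/- A unital pro-$C^*$-algebra is a unital complex $*$-algebra with a complete Hausdorff topology determined by its continuous $C^*$-seminorms. A locally convex topological vector space is barreled if every barrel (closed, absolutely convex, absorbing subset) in it is a neighborhood of the origin. A topological space $X$ is functionally Hausdorff if any two distinct points of $X$ are distinguished by some continuous function $X\to\mathbb{R}$. A subset $S\subseteq X$ is relatively compact if its closure in $X$ is compact, and relatively pseudocompact if every continuous function $X\to\mathbb{R}$ is bounded on $S$. Let $A$ be a unital commutative pro-$C^*$-algebra. Then $A$ is barreled if and only if there is a functionally Hausdorff topological space $X$, all of whose relatively pseudocompact subsets are relatively compact, such that $A$ is isomorphic, by a $*$-isomorphism that is also a homeomorphism, to the algebra $C(X)$ of all continuous functions $X\to\mathbb{C}$ with the compact-open topology. -/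

import Mathlib

open Topology

universe u

/-- A C*-seminorm on a complex *-algebra: a submultiplicative, *-invariant seminorm `p` with
`p (a* a) = p a ^ 2`. -/
structure IsCStarSeminorm {A : Type*} [Ring A] [StarRing A] [Algebra ℂ A]
    (p : Seminorm ℂ A) : Prop where
  map_mul_le : ∀ a b : A, p (a * b) ≤ p a * p b
  map_star : ∀ a : A, p (star a) = p a
  map_star_mul_self : ∀ a : A, p (star a * a) = p a ^ 2

/-- A unital pro-C*-algebra: a unital complex *-algebra with a complete Hausdorff (vector space)
topology which is determined by its continuous C*-seminorms. Here `UniformSpace A` together with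
`IsUniformAddGroup A` is the topology with its canonical translation-invariant uniformity.
Continuity of scalar multiplication, of the product and of the involution follow. -/
class UnitalProCStarAlgebra (A : Type*) [Ring A] [StarRing A] [Algebra ℂ A] [StarModule ℂ A]
    [UniformSpace A] : Prop where
  isUniformAddGroup : IsUniformAddGroup A
  completeSpace : CompleteSpace A
  t2Space : T2Space A
  withSeminorms : WithSeminorms
    (fun p : {p : Seminorm ℂ A // Continuous p ∧ IsCStarSeminorm p} => p.1)

/-- A barrel in a complex topological vector space: an absolutely convex (i.e. convex and
balanced), absorbing, closed set. -/
structure IsBarrel {V : Type*} [AddCommGroup V] [Module ℂ V] [TopologicalSpace V]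
    (B : Set V) : Prop where
  convex : Convex ℝ B
  balanced : Balanced ℂ B
  absorbent : Absorbent ℂ B
  isClosed : IsClosed B

/-- A (complex, locally convex) topological vector space is barreled if every barrel is a
neighborhood of the origin. -/
def IsBarreled (V : Type*) [AddCommGroup V] [Module ℂ V] [TopologicalSpace V] : Prop :=
  ∀ B : Set V, IsBarrel B → B ∈ 𝓝 (0 : V)

/-- The definition through barrels agrees with Mathlib's `BarrelledSpace`. -/
theorem isBarreled_iff_barrelledSpace (V : Type*) [AddCommGroup V] [Module ℂ V]
    [TopologicalSpace V] [IsTopologicalAddGroup V] [ContinuousSMul ℂ V] :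
    IsBarreled V ↔ BarrelledSpace ℂ V := by
  constructor
  · intro h
    refine ⟨fun p hp => ?_⟩
    refine Seminorm.continuous' (r := 1) (h _ ⟨?_, ?_, ?_, ?_⟩)
    · exact p.convex_closedBall 0 1
    · exact p.balanced_closedBall_zero 1
    · exact p.absorbent_closedBall_zero one_pos
    · rw [Seminorm.closedBall_zero_eq]
      exact hp.isClosed_preimage 1
  · intro h B hB
    have hR : Absorbent ℝ B := by
      intro x
      have h1 := (absorbent_iff_eventually_nhdsNE_zero.1 hB.absorbent) x
      have h2 : Filter.Tendsto (fun c : ℝ => (c : ℂ)) (𝓝[≠] 0) (𝓝[≠] 0) := by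
        refine tendsto_nhdsWithin_iff.2 ⟨?_, ?_⟩
        · refine (Complex.continuous_ofReal.tendsto' 0 0 (by simp)).mono_left nhdsWithin_le_nhds
        · filter_upwards [self_mem_nhdsWithin] with c hc
          simpa using hc
      have h3 := h2.eventually h1
      refine absorbs_iff_eventually_nhdsNE_zero.2 ?_
      filter_upwards [h3] with c hc
      intro y hy
      obtain rfl : y = x := hy
      simpa using hc
    let q := gaugeSeminorm hB.balanced hB.convex hR
    have hq : ∀ v, q v ≤ 1 ↔ v ∈ B := by
      intro v
      have : ContinuousSMul ℝ V := IsScalarTower.continuousSMul ℂ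
      refine ⟨fun hv => ?_, fun hv => gauge_le_one_of_mem hv⟩
      have := mem_closure_of_gauge_le_one hB.convex (hB.absorbent.zero_mem) hR hv
      rwa [hB.isClosed.closure_eq] at this
    have hlsc : LowerSemicontinuous q := by
      refine lowerSemicontinuous_iff_isClosed_preimage.2 fun y => ?_
      have key : ∀ r : ℝ, 0 < r → IsClosed {v | q v ≤ r} := by
        intro r hr
        have : {v | q v ≤ r} = (fun v => ((r⁻¹ : ℝ) : ℂ) • v) ⁻¹' B := by
          ext v
          rw [Set.mem_preimage, ← hq, map_smul_eq_mul, Complex.norm_real,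
            Real.norm_of_nonneg (by positivity), Set.mem_ofPred_eq, inv_mul_le_iff₀ hr, mul_one]
        rw [this]
        exact hB.isClosed.preimage (continuous_const_smul _)
      have : q ⁻¹' Set.Iic y = ⋂ r : {r : ℝ // 0 < r ∧ y ≤ r}, {v | q v ≤ r} ∩ {_v : V | 0 ≤ y} := by
        ext v
        simp only [Set.mem_preimage, Set.mem_Iic, Set.mem_iInter, Set.mem_inter_iff,
          Set.mem_ofPred_eq, Subtype.forall]
        refine ⟨fun hv r hr => ⟨hv.trans hr.2, (apply_nonneg q v).trans hv⟩, fun hv => ?_⟩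
        have h0 := (hv (max y 1) ⟨by positivity, le_max_left _ _⟩).2
        refine le_of_forall_pos_le_add fun e he => ?_
        exact (hv (y + e) ⟨by positivity, by linarith⟩).1
      rw [this]
      exact isClosed_iInter fun r => (key r r.2.1).inter isClosed_const
    have hc : Continuous q := q.continuous_of_lowerSemicontinuous hlsc
    have : {v | q v < 1} ∈ 𝓝 (0 : V) :=
      (isOpen_lt hc continuous_const).mem_nhds (by simp)
    exact Filter.mem_of_superset this fun v hv => (hq v).1 (le_of_lt hv)

/-- Distinct points are separated by a continuous real-valued function. -/
def FunctionallyHausdorff (X : Type*) [TopologicalSpace X] : Prop :=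
  ∀ x y : X, x ≠ y → ∃ f : C(X, ℝ), f x ≠ f y

/-- `S ⊆ X` is relatively pseudocompact if every continuous real-valued function on the whole of
`X` is bounded on `S`. -/
def IsRelativelyPseudocompact {X : Type*} [TopologicalSpace X] (S : Set X) : Prop :=
  ∀ f : C(X, ℝ), ∃ M : ℝ, ∀ x ∈ S, |f x| ≤ M

/-- `S ⊆ X` is relatively compact if its closure is compact. -/
def IsRelativelyCompact {X : Type*} [TopologicalSpace X] (S : Set X) : Prop :=
  IsCompact (closure S)

/-! Take for `X` the space of continuous *-characters of `A` with the pointwise topology. A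
continuous C*-seminorm `p` is the supremum of `‖φ a‖` over the compact set `dominated p`. With
Stone–Weierstrass and completeness, this makes `gelfand` a *-isomorphism onto `C(X)` with continuous
inverse, barreled or not. Barreledness enters in `exists_seminorm_bound`: the polar of a relatively
pseudocompact set of characters is a barrel, so the set lies in some `dominated p`. This gives both
the continuity of `gelfand` and the compactness condition on `X`.

The converse is the Nachbin–Shirota argument. A lower semicontinuous seminorm on `C(X)` has a closed
support, its `hull`, which is always relatively pseudocompact; once the hull is compact, the
seminorm is continuous. -/

/-- A point of the spectrum at which a commutative C*-algebra element attains its norm. -/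
theorem CommCStarAlgebra.exists_character_norm_eq {B : Type*} [CommCStarAlgebra B] [Nontrivial B]
    (b : B) : ∃ φ : B →⋆ₐ[ℂ] ℂ, (∀ x, ‖φ x‖ ≤ ‖x‖) ∧ ‖φ b‖ = ‖b‖ := by
  have hb : ‖WeakDual.gelfandTransform ℂ B b‖ = ‖b‖ := by
    simpa using (gelfandTransform_isometry B).norm_map_of_map_zero (map_zero _) b
  obtain ⟨φ, -, hφ⟩ := isCompact_univ.exists_isMaxOn
    (Set.univ_nonempty (α := WeakDual.characterSpace ℂ B))
    (WeakDual.gelfandTransform ℂ B b).continuous.norm.continuousOn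
  refine ⟨(φ : B →⋆ₐ[ℂ] ℂ), fun x => ?_, le_antisymm ?_ ?_⟩
  · exact NonUnitalStarAlgHom.norm_apply_le (φ : B →⋆ₐ[ℂ] ℂ) x
  · exact NonUnitalStarAlgHom.norm_apply_le (φ : B →⋆ₐ[ℂ] ℂ) b
  · rw [← hb, ContinuousMap.norm_le _ (norm_nonneg _)]
    exact fun ψ => hφ (Set.mem_univ ψ)

/-! ### Characters attaining a C*-seminorm -/

section Completion

open UniformSpace

variable {E : Type*} [SeminormedCommRing E] [StarRing E] [NormedAlgebra ℂ E] [StarModule ℂ E]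

/-- The completion of a seminormed *-algebra with the C*-identity is a C*-algebra. -/
@[reducible]
noncomputable def UniformSpace.Completion.commCStarAlgebra (h₁ : ∀ a : E, ‖star a‖ = ‖a‖)
    (h₂ : ∀ a : E, ‖star a * a‖ = ‖a‖ ^ 2) : CommCStarAlgebra (Completion E) :=
  have hs : UniformContinuous (star : E → E) := by
    refine (AddMonoidHomClass.isometry_of_norm (starAddEquiv : E ≃+ E) fun a => h₁ a).uniformContinuous
  let st : Star (Completion E) := ⟨Completion.map star⟩
  have coe (a : E) : star (a : Completion E) = ((star a : E) : Completion E) :=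
    Completion.map_coe hs a
  have cont : Continuous (star : Completion E → Completion E) := Completion.continuous_map
  let sr : StarRing (Completion E) :=
    { star_involutive := fun x => by
        induction x using Completion.induction_on with
        | hp => exact isClosed_eq (cont.comp cont) continuous_id
        | ih a => rw [coe, coe, star_star]
      star_mul := fun x y => by
        induction x, y using Completion.induction_on₂ with
        | hp => exact isClosed_eq (cont.comp continuous_mul)
                  ((cont.comp continuous_snd).mul (cont.comp continuous_fst))
        | ih a b => rw [← Completion.coe_mul, coe, coe, coe, ← Completion.coe_mul, star_mul]
      star_add := fun x y => by
        induction x, y using Completion.induction_on₂ with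
        | hp => exact isClosed_eq (cont.comp continuous_add)
                  ((cont.comp continuous_fst).add (cont.comp continuous_snd))
        | ih a b => rw [← Completion.coe_add, coe, coe, coe, ← Completion.coe_add, star_add] }
  { (inferInstance : NormedCommRing (Completion E)),
    (inferInstance : NormedAlgebra ℂ (Completion E)),
    (inferInstance : CompleteSpace (Completion E)), sr with
    norm_mul_self_le := fun x => by
      refine le_of_eq ?_
      induction x using Completion.induction_on with
      | hp => exact isClosed_eq (continuous_norm.mul continuous_norm)
                ((cont.mul continuous_id).norm)
      | ih a => rw [coe, ← Completion.coe_mul, Completion.norm_coe, Completion.norm_coe, h₂, sq]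
    star_smul := fun c x => by
      induction x using Completion.induction_on with
      | hp => exact isClosed_eq (cont.comp (continuous_const_smul c))
                (cont.const_smul (star c))
      | ih a => rw [← Completion.coe_smul, coe, coe, ← Completion.coe_smul, star_smul] }

/-- The completion also divides out the elements of norm zero, so Gelfand theory applies to it
directly; `ha` keeps it nontrivial. -/
theorem exists_character_norm_eq_of_norm_ne_zero (h₁ : ∀ a : E, ‖star a‖ = ‖a‖)
    (h₂ : ∀ a : E, ‖star a * a‖ = ‖a‖ ^ 2) (a : E) (ha : ‖a‖ ≠ 0) :
    ∃ φ : E →⋆ₐ[ℂ] ℂ, (∀ x, ‖φ x‖ ≤ ‖x‖) ∧ ‖φ a‖ = ‖a‖ := by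
  let := Completion.commCStarAlgebra h₁ h₂
  have : Nontrivial (Completion E) := ⟨(a : Completion E), 0, fun h => ha <| by
    rw [← Completion.norm_coe, h, norm_zero]⟩
  obtain ⟨φ, h, h'⟩ := CommCStarAlgebra.exists_character_norm_eq (a : Completion E)
  have hs : UniformContinuous (star : E → E) := by
    refine (AddMonoidHomClass.isometry_of_norm (starAddEquiv : E ≃+ E) fun a => h₁ a).uniformContinuous
  let ι : E →⋆ₐ[ℂ] Completion E :=
    { (Completion.coeRingHom : E →+* Completion E) with
      commutes' := fun c => rfl
      map_star' := fun x => (Completion.map_coe hs x).symm }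
  refine ⟨φ.comp ι, fun x => ?_, ?_⟩
  · exact (h _).trans (Completion.norm_coe x).le
  · exact h'.trans (Completion.norm_coe a)

end Completion

section Character

variable {A : Type*} [CommRing A] [StarRing A] [Algebra ℂ A]

theorem IsCStarSeminorm.exists_character [StarModule ℂ A] {p : Seminorm ℂ A} (hp : IsCStarSeminorm p) (a : A)
    (ha : p a ≠ 0) : ∃ φ : A →⋆ₐ[ℂ] ℂ, (∀ x, ‖φ x‖ ≤ p x) ∧ ‖φ a‖ = p a := by
  let r : RingSeminorm A := { p.toAddGroupSeminorm with mul_le' := hp.map_mul_le }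
  let i₁ : SeminormedCommRing A := { r.toSeminormedRing with mul_comm := mul_comm }
  let i₂ : NormedAlgebra ℂ A :=
    { (inferInstance : Algebra ℂ A) with norm_smul_le := fun c x => (map_smul_eq_mul p c x).le }
  exact exists_character_norm_eq_of_norm_ne_zero (E := A) hp.map_star hp.map_star_mul_self a ha

theorem IsCStarSeminorm.sup {p q : Seminorm ℂ A} (hp : IsCStarSeminorm p)
    (hq : IsCStarSeminorm q) : IsCStarSeminorm (p ⊔ q) where
  map_mul_le a b := by
    simp only [Seminorm.sup_apply]
    refine max_le ((hp.map_mul_le a b).trans ?_) ((hq.map_mul_le a b).trans ?_) <;> gcongr <;> simp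
  map_star a := by simp only [Seminorm.sup_apply, hp.map_star, hq.map_star]
  map_star_mul_self a := by
    simp only [Seminorm.sup_apply, hp.map_star_mul_self, hq.map_star_mul_self]
    rcases le_total (p a) (q a) with h | h
    · rw [max_eq_right h, max_eq_right (pow_le_pow_left₀ (apply_nonneg p a) h 2)]
    · rw [max_eq_left h, max_eq_left (pow_le_pow_left₀ (apply_nonneg q a) h 2)]

theorem IsCStarSeminorm.bot : IsCStarSeminorm (⊥ : Seminorm ℂ A) where
  map_mul_le a b := by simp
  map_star a := by simp
  map_star_mul_self a := by simp

theorem StarAlgHom.isCStarSeminorm_norm (φ : A →⋆ₐ[ℂ] ℂ) :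
    IsCStarSeminorm ((normSeminorm ℂ ℂ).comp φ.toAlgHom.toLinearMap) where
  map_mul_le a b := by simp
  map_star a := by simp [map_star]
  map_star_mul_self a := by simp [map_star, sq]

end Character

/-! ### Lower semicontinuous seminorms and closed ideals of `C(X)` -/

section Seminorm

variable {X : Type*} [TopologicalSpace X]

theorem ContinuousMap.hasBasis_nhds_norm_sub (f : C(X, ℂ)) :
    (𝓝 f).HasBasis (fun p : Set X × ℝ => IsCompact p.1 ∧ 0 < p.2)
      fun p => {g | ∀ x ∈ p.1, ‖g x - f x‖ < p.2} := by
  refine (nhds_basis_uniformity Metric.uniformity_basis_dist.compactConvergenceUniformity).congr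
    (fun _ => Iff.rfl) fun p _ => ?_
  simp only [Set.mem_ofPred_eq, dist_eq_norm]

theorem ContinuousMap.continuous_mul_const_apply (F : C(X, ℂ)) :
    Continuous fun h : C(X, ℂ) => h * F := by
  refine continuous_iff_continuousAt.2 fun f => ?_
  refine ((hasBasis_nhds_norm_sub f).tendsto_iff (hasBasis_nhds_norm_sub (f * F))).2 ?_
  rintro ⟨K, ε⟩ ⟨hK, hε⟩
  obtain ⟨M, hM⟩ := hK.exists_bound_of_continuousOn F.continuous.continuousOn
  have hM' : 0 < |M| + 1 := by positivity
  refine ⟨(K, ε / (|M| + 1)), ⟨hK, div_pos hε hM'⟩, fun g hg x hx => ?_⟩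
  have h1 : (g * F) x - (f * F) x = (g x - f x) * F x := by simp [sub_mul]
  rw [h1, norm_mul]
  calc ‖g x - f x‖ * ‖F x‖ ≤ ‖g x - f x‖ * (|M| + 1) := by
        gcongr
        linarith [hM x hx, le_abs_self M]
    _ < ε := (lt_div_iff₀ hM').1 (hg x hx)

/-- A lower semicontinuous seminorm on `C(X, ℂ)` is bounded on bounded multiples of each `F`. -/
theorem LowerSemicontinuous.exists_bound_mul {q : Seminorm ℂ C(X, ℂ)} (hq : LowerSemicontinuous q)
    (F : C(X, ℂ)) : ∃ C : ℝ, 0 ≤ C ∧ ∀ (h : C(X, ℂ)) (M : ℝ), 0 ≤ M → (∀ x, ‖h x‖ ≤ M) →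
      q (h * F) ≤ C * M := by
  let T : BoundedContinuousFunction X ℂ →ₗ[ℂ] C(X, ℂ) :=
    { toFun := fun h => h.toContinuousMap * F
      map_add' := fun a b => by ext; simp [add_mul]
      map_smul' := fun c a => by ext; simp [mul_assoc] }
  have hT : Continuous T := by
    refine (ContinuousMap.continuous_mul_const_apply F).comp ?_
    refine ContinuousMap.continuous_of_continuous_uncurry _ ?_
    exact continuous_eval
  -- Bounded continuous functions form a Banach space, which is barreled.
  have hc : Continuous (q.comp T) := Seminorm.continuous_of_lowerSemicontinuous _ (hq.comp hT)
  obtain ⟨C, hC, h⟩ := Seminorm.bound_of_continuous_normedSpace _ hc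
  refine ⟨C, hC.le, fun f M hM hf => ?_⟩
  let b := BoundedContinuousFunction.ofNormedAddCommGroup f f.continuous M hf
  refine (h b).trans ?_
  gcongr
  exact BoundedContinuousFunction.norm_ofNormedAddCommGroup_le _ hM _

/-- The largest ideal of `C(X, ℂ)` on which the seminorm vanishes. -/
def Seminorm.nullIdeal (q : Seminorm ℂ C(X, ℂ)) : Ideal C(X, ℂ) where
  carrier := {f | ∀ h, q (h * f) = 0}
  zero_mem' h := by simp
  add_mem' {a b} ha hb h := by
    refine le_antisymm ?_ (apply_nonneg q _)
    rw [mul_add]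
    exact (map_add_le_add q _ _).trans (by simp [ha h, hb h])
  smul_mem' c f hf h := by
    rw [smul_eq_mul, ← mul_assoc]
    exact hf _

theorem Seminorm.mem_nullIdeal {q : Seminorm ℂ C(X, ℂ)} {f : C(X, ℂ)} :
    f ∈ q.nullIdeal ↔ ∀ h, q (h * f) = 0 := Iff.rfl

theorem LowerSemicontinuous.isClosed_nullIdeal {q : Seminorm ℂ C(X, ℂ)}
    (hq : LowerSemicontinuous q) : IsClosed (q.nullIdeal : Set C(X, ℂ)) := by
  have : (q.nullIdeal : Set C(X, ℂ)) = ⋂ h : C(X, ℂ), (fun f => f * h) ⁻¹' (q ⁻¹' Set.Iic 0) := by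
    ext f
    simp only [SetLike.mem_coe, Seminorm.mem_nullIdeal, Set.mem_iInter, Set.mem_preimage,
      Set.mem_Iic]
    refine forall_congr' fun h => ?_
    rw [mul_comm h f]
    exact ⟨fun e => e.le, fun e => le_antisymm e (apply_nonneg q _)⟩
  rw [this]
  exact isClosed_iInter fun h => (hq.isClosed_preimage 0).preimage (ContinuousMap.continuous_mul_const_apply h)

/-- The support of a seminorm on `C(X, ℂ)`. -/
def Seminorm.hull (q : Seminorm ℂ C(X, ℂ)) : Set X :=
  {x | ∀ f ∈ q.nullIdeal, f x = 0}

theorem Seminorm.isClosed_hull (q : Seminorm ℂ C(X, ℂ)) : IsClosed q.hull := by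
  have : q.hull = ⋂ f ∈ q.nullIdeal, {x | f x = 0} := by
    ext x
    simp [Seminorm.hull]
  rw [this]
  exact isClosed_biInter fun f _ => isClosed_eq f.continuous continuous_const

/-- A closed ideal of `C(X, ℂ)` contains every function vanishing at its common zeros. -/
theorem ContinuousMap.mem_of_isClosed_ideal {I : Ideal C(X, ℂ)} (hI : IsClosed (I : Set C(X, ℂ)))
    {f : C(X, ℂ)} (hf : ∀ x, (∀ g ∈ I, g x = 0) → f x = 0) : f ∈ I := by
  rw [← SetLike.mem_coe, ← hI.closure_eq, mem_closure_iff_nhds_basis (hasBasis_nhds_norm_sub f)]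
  rintro ⟨K, ε⟩ ⟨hK, hε⟩
  let L := K ∩ {x | ε ≤ ‖f x‖}
  have hL : IsCompact L :=
    hK.inter_right (isClosed_le continuous_const f.continuous.norm)
  have key : ∀ x ∈ L, ∃ g ∈ I, g x ≠ 0 := by
    intro x hx
    by_contra! h
    have := hx.2
    rw [Set.mem_ofPred_eq, hf x h, norm_zero] at this
    exact absurd this (not_le.2 hε)
  choose! g hgI hg using key
  obtain ⟨t, htL, ht⟩ := hL.elim_nhds_subcover (fun x => {y | g x y ≠ 0})
    (fun x hx => (isOpen_ne_fun (g x).continuous continuous_const).mem_nhds (hg x hx))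
  -- A sum of squares `star g * g` lies in the ideal and is positive on `L`, the part of `K` where
  -- `f` is not small.
  let u : C(X, ℝ) := ⟨fun y => ∑ x ∈ t, ‖g x y‖ ^ 2, by fun_prop⟩
  have hu : ∀ y, (u y : ℂ) = ∑ x ∈ t, star (g x y) * g x y := by
    intro y
    simp only [u, ContinuousMap.coe_mk, Complex.ofReal_sum]
    refine Finset.sum_congr rfl fun x _ => ?_
    rw [Complex.star_def, Complex.conj_mul', Complex.ofReal_pow]
  have hu0 : ∀ y, 0 ≤ u y := fun y => Finset.sum_nonneg fun x _ => by positivity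
  have hupos : ∀ y ∈ L, 0 < u y := by
    intro y hy
    obtain ⟨x, hx, hxy⟩ := Set.mem_iUnion₂.1 (ht hy)
    exact Finset.sum_pos' (fun x _ => by positivity) ⟨x, hx, by
      have : g x y ≠ 0 := hxy
      positivity⟩
  obtain ⟨c, hc, hcu⟩ : ∃ c : ℝ, 0 < c ∧ ∀ y ∈ L, c ≤ u y := by
    rcases L.eq_empty_or_nonempty with h | h
    · exact ⟨1, one_pos, by simp [h]⟩
    · obtain ⟨y, hy, hmin⟩ := hL.exists_isMinOn h u.continuous.continuousOn
      exact ⟨u y, hupos y hy, fun z hz => hmin hz⟩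
  have hm : ∀ y, 0 < max (u y) c := fun y => lt_max_of_lt_right hc
  -- Then `k * U = f * (u / max u c)`: equal to `f` on `L`, and elsewhere on `K` off by at most `‖f‖
  -- < ε`.
  let k : C(X, ℂ) := ⟨fun y => f y * ((max (u y) c)⁻¹ : ℝ), by
    have : Continuous fun y => (max (u y) c)⁻¹ :=
      (u.continuous.max continuous_const).inv₀ fun y => (hm y).ne'
    fun_prop⟩
  let U : C(X, ℂ) := ∑ x ∈ t, star (g x) * g x
  have hUI : U ∈ I := I.sum_mem fun x hx => I.mul_mem_left _ (hgI x (htL x hx))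
  have hU : ∀ y, U y = (u y : ℂ) := by
    intro y
    simp [U, hu]
  refine ⟨k * U, I.mul_mem_left _ hUI, fun y hy => ?_⟩
  have hval : (k * U) y = f y * ((u y / max (u y) c : ℝ) : ℂ) := by
    simp only [ContinuousMap.mul_apply, hU, k, ContinuousMap.coe_mk, Complex.ofReal_inv,
      Complex.ofReal_div]
    ring
  rw [hval]
  by_cases hyL : ε ≤ ‖f y‖
  · rw [max_eq_left (hcu y ⟨hy, hyL⟩), div_self (hupos y ⟨hy, hyL⟩).ne']
    simpa using hε
  · have h1 : u y / max (u y) c ≤ 1 := (div_le_one (hm y)).2 (le_max_left _ _)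
    have h0 : 0 ≤ u y / max (u y) c := div_nonneg (hu0 y) (hm y).le
    have : f y * ((u y / max (u y) c : ℝ) : ℂ) - f y = f y * ((u y / max (u y) c - 1 : ℝ) : ℂ) := by
      push_cast
      ring
    rw [this, norm_mul, Complex.norm_real, Real.norm_eq_abs, abs_of_nonpos (by linarith)]
    refine lt_of_le_of_lt ?_ (not_le.1 hyL)
    exact mul_le_of_le_one_right (norm_nonneg _) (by linarith)

end Seminorm

/-! ### The Nachbin–Shirota theorem -/

section Nachbin

variable {X : Type*} [TopologicalSpace X]

/-- A gliding hump: if `g` is unbounded on the hull, bumps at well-separated levels of `|g|` carry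
functions with `q (f n) = n`. Their locally finite sum `F` recovers each as `B n * F` with `‖B n‖ ≤
1`, contradicting `exists_bound_mul`. -/
theorem LowerSemicontinuous.isRelativelyPseudocompact_hull {q : Seminorm ℂ C(X, ℂ)}
    (hq : LowerSemicontinuous q) : IsRelativelyPseudocompact q.hull := by
  intro g
  by_contra! hunb
  choose pt hpt hlt using hunb
  -- The increment 2 separates the levels `y n` by more than 2, so that a point within 1 of one
  -- level is more than 1 from all others.
  let z : ℕ → ℝ := Nat.rec 0 fun _ r => |g (pt r)| + 2
  let y : ℕ → ℝ := fun n => |g (pt (z n))|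
  have hz (n : ℕ) : z n < y n := hlt (z n)
  have hstep (n : ℕ) : y n + 2 < y (n + 1) := hz (n + 1)
  have hsep : ∀ m n, m < n → y m + 2 < y n := by
    intro m n h
    induction n, h using Nat.le_induction with
    | base => exact hstep m
    | succ n _ ih => linarith [hstep n]
  have hge (n : ℕ) : (n : ℝ) ≤ y n := by
    induction n with
    | zero => simp [y]
    | succ n ih => push_cast; linarith [hstep n]
  let b : ℕ → C(X, ℂ) := fun n => ⟨fun x => (max 0 (1 - 2 * |(|g x| - y n)|) : ℝ), by fun_prop⟩
  have hb (n : ℕ) (x : X) (hx : 1 / 2 ≤ |(|g x| - y n)|) : b n x = 0 := by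
    simp only [b, ContinuousMap.coe_mk, Complex.ofReal_eq_zero]
    exact max_eq_left (by linarith)
  -- `b n` equals 1 at the hull point `pt (z n)`.
  have hbN (n : ℕ) : b n ∉ q.nullIdeal := fun h => by
    have := hpt (z n) _ h
    simp [b, y] at this
  have hex (n : ℕ) : ∃ h, q (h * b n) ≠ 0 := by
    have := hbN n
    rw [Seminorm.mem_nullIdeal] at this
    push Not at this
    exact this
  choose h hh using hex
  let f : ℕ → C(X, ℂ) := fun n => ((n / q (h n * b n) : ℝ) : ℂ) • (h n * b n)
  have hqf (n : ℕ) : q (f n) = n := by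
    simp only [f, map_smul_eq_mul, Complex.norm_real, Real.norm_eq_abs]
    rw [abs_of_nonneg (div_nonneg n.cast_nonneg (apply_nonneg q _)), div_mul_cancel₀ _ (hh n)]
  have hf (n : ℕ) (x : X) (hx : 1 / 2 ≤ |(|g x| - y n)|) : f n x = 0 := by
    simp [f, hb n x hx]
  have hfin : LocallyFinite fun n => Function.support (f n) := by
    intro x
    refine ⟨{w | |g w| < |g x| + 1}, (isOpen_lt (by fun_prop) (by fun_prop)).mem_nhds (by simp), ?_⟩
    refine (Set.finite_le_nat ⌈|g x| + 2⌉₊).subset ?_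
    rintro n ⟨w, hw, hwx⟩
    have h1 : |(|g w| - y n)| < 1 / 2 := by
      by_contra! h
      exact hw (hf n w h)
    have h2 : |g w| < |g x| + 1 := hwx
    have h3 : (n : ℝ) ≤ ⌈|g x| + 2⌉₊ := by
      linarith [(abs_lt.1 h1).1, hge n, Nat.le_ceil (|g x| + 2)]
    exact_mod_cast h3
  let F : C(X, ℂ) := ⟨fun x => ∑ᶠ n, f n x, continuous_finsum (fun n => (f n).continuous) hfin⟩
  -- `B n` is 1 wherever `f n` can be nonzero and vanishes at distance 1 from level `y n`, before
  -- any other `f m` is met.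
  let B : ℕ → C(X, ℂ) := fun n =>
    ⟨fun x => (max 0 (min 1 (2 - 2 * |(|g x| - y n)|)) : ℝ), by fun_prop⟩
  have hBF (n : ℕ) : B n * F = f n := by
    ext x
    rw [ContinuousMap.mul_apply]
    rcases le_or_gt 1 |(|g x| - y n)| with hx | hx
    · rw [hf n x (by linarith)]
      have : B n x = 0 := by
        simp only [B, ContinuousMap.coe_mk, Complex.ofReal_eq_zero]
        exact max_eq_left ((min_le_right _ _).trans (by linarith))
      rw [this, zero_mul]
    · have hF : F x = f n x := by
        refine finsum_eq_single _ n fun m hm => hf m x ?_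
        have hx' := abs_lt.1 hx
        rcases lt_or_gt_of_ne hm with hmn | hmn
        · exact le_trans (by linarith [hsep m n hmn]) (le_abs_self _)
        · exact le_trans (by linarith [hsep n m hmn]) (neg_le_abs _)
      rw [hF]
      rcases le_or_gt (1 / 2) |(|g x| - y n)| with hx' | hx'
      · rw [hf n x hx', mul_zero]
      · have : B n x = 1 := by
          simp only [B, ContinuousMap.coe_mk]
          rw [min_eq_left (by linarith), max_eq_right zero_le_one, Complex.ofReal_one]
        rw [this, one_mul]
  obtain ⟨C, -, hC⟩ := hq.exists_bound_mul F
  obtain ⟨n, hn⟩ := exists_nat_gt C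
  have := hC (B n) 1 zero_le_one fun x => by
    simp only [B, ContinuousMap.coe_mk, Complex.norm_real, Real.norm_eq_abs]
    rw [abs_of_nonneg (le_max_left _ _)]
    exact max_le zero_le_one (min_le_left _ _)
  rw [hBF, hqf, mul_one] at this
  exact absurd hn (not_lt.2 this)

/-- If `f` is smaller than `δ` on the hull, truncating it to modulus `δ` changes it only by an
element of the closed ideal `nullIdeal`, so `q f` is controlled by the bound for bounded functions.
-/
theorem LowerSemicontinuous.continuous_of_isCompact_hull {q : Seminorm ℂ C(X, ℂ)}
    (hq : LowerSemicontinuous q) (hK : IsCompact q.hull) : Continuous q := by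
  obtain ⟨C, hC, hb⟩ := hq.exists_bound_mul 1
  have hC1 : 0 < C + 1 := by positivity
  let δ := 1 / (C + 1)
  have hδ : 0 < δ := by positivity
  refine Seminorm.continuous' (r := 1) ?_
  refine ((ContinuousMap.hasBasis_nhds_norm_sub (0 : C(X, ℂ))).mem_iff).2
    ⟨(q.hull, δ), ⟨hK, hδ⟩, fun f hf => ?_⟩
  have hm (x : X) : 0 < max ‖f x‖ δ := lt_max_of_lt_right hδ
  let k : C(X, ℂ) := ⟨fun x => f x * ((δ / max ‖f x‖ δ : ℝ) : ℂ), by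
    have : Continuous fun x => δ / max ‖f x‖ δ :=
      continuous_const.div (f.continuous.norm.max continuous_const) fun x => (hm x).ne'
    fun_prop⟩
  have hk (x : X) : ‖k x‖ ≤ δ := by
    simp only [k, ContinuousMap.coe_mk, norm_mul, Complex.norm_real, Real.norm_eq_abs]
    rw [abs_of_nonneg (div_nonneg hδ.le (hm x).le), mul_div_assoc', div_le_iff₀ (hm x), mul_comm]
    gcongr
    exact le_max_left _ _
  have hfk : f - k ∈ q.nullIdeal := by
    refine ContinuousMap.mem_of_isClosed_ideal hq.isClosed_nullIdeal fun x hx => ?_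
    have h1 : ‖f x‖ < δ := by simpa using hf x hx
    have h2 : (δ : ℂ) ≠ 0 := by exact_mod_cast hδ.ne'
    simp [k, max_eq_right h1.le, div_self h2]
  have h0 : q (f - k) = 0 := by simpa using Seminorm.mem_nullIdeal.1 hfk 1
  rw [Seminorm.mem_closedBall_zero]
  calc q f = q ((f - k) + k * 1) := by simp
    _ ≤ q (f - k) + q (k * 1) := map_add_le_add q _ _
    _ ≤ C * δ := by rw [h0, zero_add]; exact hb k δ hδ.le hk
    _ ≤ 1 := by
      rw [mul_one_div, div_le_one hC1]
      linarith

/-- The Nachbin–Shirota theorem, in the direction that produces barreled function spaces. -/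
theorem ContinuousMap.barrelledSpace
    (hX : ∀ S : Set X, IsRelativelyPseudocompact S → IsRelativelyCompact S) :
    BarrelledSpace ℂ C(X, ℂ) where
  continuous_of_lowerSemicontinuous q hq := by
    have h : IsCompact (closure q.hull) := hX _ hq.isRelativelyPseudocompact_hull
    rw [q.isClosed_hull.closure_eq] at h
    exact hq.continuous_of_isCompact_hull h

end Nachbin

/-- Hence balls of a single continuous C*-seminorm form a neighborhood basis of zero. -/
theorem IsCStarSeminorm.continuous_finset_sup {A : Type*} [CommRing A] [StarRing A] [Algebra ℂ A]
    [TopologicalSpace A] (s : Finset {p : Seminorm ℂ A // Continuous p ∧ IsCStarSeminorm p}) :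
    Continuous (s.sup fun p => p.1 : Seminorm ℂ A) ∧
      IsCStarSeminorm (s.sup fun p => p.1 : Seminorm ℂ A) := by
  refine Finset.sup_induction (p := fun q : Seminorm ℂ A => Continuous q ∧ IsCStarSeminorm q)
    ⟨?_, .bot⟩ (fun p hp q hq => ⟨?_, hp.2.sup hq.2⟩) fun p _ => p.2
  · exact continuous_const (y := (0 : ℝ))
  · exact hp.1.sup hq.1

/-! ### The space of continuous characters -/

section Spectrum

variable (A : Type u) [CommRing A] [StarRing A] [Algebra ℂ A] [TopologicalSpace A]

/-- The continuous *-characters of a topological *-algebra. -/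
def ContinuousCharacter : Type u := {φ : A →⋆ₐ[ℂ] ℂ // Continuous φ}

variable {A}

namespace ContinuousCharacter

/-- The topology of pointwise convergence. -/
noncomputable instance : TopologicalSpace (ContinuousCharacter A) :=
  TopologicalSpace.induced (fun φ a => φ.1 a) inferInstance

theorem isInducing_eval : IsInducing fun (φ : ContinuousCharacter A) (a : A) => φ.1 a := ⟨rfl⟩

theorem continuous_eval (a : A) : Continuous fun φ : ContinuousCharacter A => φ.1 a :=
  (continuous_apply a).comp isInducing_eval.continuous

theorem isEmbedding_eval : IsEmbedding fun (φ : ContinuousCharacter A) (a : A) => φ.1 a :=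
  ⟨isInducing_eval, fun _ _ h => Subtype.ext (StarAlgHom.ext fun a => congrFun h a)⟩

instance : T2Space (ContinuousCharacter A) := isEmbedding_eval.t2Space

theorem functionallyHausdorff : FunctionallyHausdorff (ContinuousCharacter A) := by
  intro φ ψ h
  obtain ⟨a, ha⟩ : ∃ a, φ.1 a ≠ ψ.1 a := by
    by_contra! h'
    exact h (isEmbedding_eval.injective (funext h'))
  by_cases hre : (φ.1 a).re = (ψ.1 a).re
  · exact ⟨⟨fun χ => (χ.1 a).im, Complex.continuous_im.comp (continuous_eval a)⟩,
      fun him => ha (Complex.ext hre him)⟩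
  · exact ⟨⟨fun χ => (χ.1 a).re, Complex.continuous_re.comp (continuous_eval a)⟩, hre⟩

/-- The characters dominated by a given seminorm. -/
def dominated (p : Seminorm ℂ A) : Set (ContinuousCharacter A) := {φ | ∀ a, ‖φ.1 a‖ ≤ p a}

theorem isCompact_dominated [IsTopologicalAddGroup A] {p : Seminorm ℂ A} (hp : Continuous p) :
    IsCompact (dominated p) := by
  rw [isEmbedding_eval.isCompact_iff]
  refine (isCompact_univ_pi fun a => isCompact_closedBall (0 : ℂ) (p a)).of_isClosed_subset ?_ ?_
  -- The image is cut out by closed conditions: the bound by `p` makes any function satisfying the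
  -- algebraic identities a continuous character.
  · have : (fun (φ : ContinuousCharacter A) (a : A) => φ.1 a) '' dominated p =
        {f : A → ℂ | f 1 = 1 ∧ (∀ a b, f (a * b) = f a * f b) ∧ (∀ a b, f (a + b) = f a + f b) ∧
          (∀ c : ℂ, f (algebraMap ℂ A c) = c) ∧ (∀ a, f (star a) = star (f a)) ∧
          ∀ a, ‖f a‖ ≤ p a} := by
      ext f
      constructor
      · rintro ⟨φ, hφ, rfl⟩
        refine ⟨map_one φ.1, map_mul φ.1, map_add φ.1, fun c => ?_, map_star φ.1, hφ⟩
        simpa using AlgHomClass.commutes φ.1 c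
      · rintro ⟨h1, hm, ha, hc, hs, hb⟩
        have h0 : f 0 = 0 := by simpa using ha 0 0
        let φ : A →⋆ₐ[ℂ] ℂ :=
          { toFun := f, map_one' := h1, map_mul' := hm, map_zero' := h0, map_add' := ha
            commutes' := hc, map_star' := hs }
        have hφ : Continuous φ := by
          refine continuous_of_continuousAt_zero φ ?_
          rw [ContinuousAt, map_zero]
          exact squeeze_zero_norm (fun a => hb a) (by simpa using hp.tendsto 0)
        exact ⟨⟨φ, hφ⟩, hb, rfl⟩
    rw [this]
    simp only [Set.ofPred_and, Set.ofPred_forall]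
    refine (isClosed_eq (by fun_prop) (by fun_prop)).inter <|
      (isClosed_iInter fun a => isClosed_iInter fun b =>
        isClosed_eq (by fun_prop) (by fun_prop)).inter <|
      (isClosed_iInter fun a => isClosed_iInter fun b =>
        isClosed_eq (by fun_prop) (by fun_prop)).inter <|
      (isClosed_iInter fun c => isClosed_eq (by fun_prop) (by fun_prop)).inter <|
      (isClosed_iInter fun a => isClosed_eq (by fun_prop) (by fun_prop)).inter <|
      isClosed_iInter fun a => isClosed_le (by fun_prop) (by fun_prop)
  · rintro _ ⟨φ, hφ, rfl⟩ a -
    simpa using hφ a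

theorem exists_mem_dominated (φ : ContinuousCharacter A) :
    ∃ p : Seminorm ℂ A, Continuous p ∧ IsCStarSeminorm p ∧ φ ∈ dominated p :=
  ⟨_, φ.2.norm, φ.1.isCStarSeminorm_norm, fun _ => le_rfl⟩

/-- The Gelfand transform on continuous *-characters. -/
noncomputable def gelfand : A →⋆ₐ[ℂ] C(ContinuousCharacter A, ℂ) where
  toFun a := ⟨fun φ => φ.1 a, continuous_eval a⟩
  map_one' := by ext; simp
  map_mul' a b := by ext; simp
  map_zero' := by ext; simp
  map_add' a b := by ext; simp
  commutes' c := by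
    ext φ
    simpa using AlgHomClass.commutes φ.1 c
  map_star' a := by ext φ; simp [map_star]

@[simp]
theorem gelfand_apply (a : A) (φ : ContinuousCharacter A) : gelfand a φ = φ.1 a := rfl

/-- Gelfand transforms approximate continuous functions on compact sets of characters. -/
theorem exists_gelfand_near (f : C(ContinuousCharacter A, ℂ)) {K : Set (ContinuousCharacter A)}
    (hK : IsCompact K) {ε : ℝ} (hε : 0 < ε) : ∃ a, ∀ φ ∈ K, ‖φ.1 a - f φ‖ < ε := by
  have : CompactSpace K := isCompact_iff_compactSpace.1 hK
  let r : A →⋆ₐ[ℂ] C(K, ℂ) :=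
    (ContinuousMap.compStarAlgHom' ℂ ℂ ⟨(Subtype.val : K → _), continuous_subtype_val⟩).comp gelfand
  have hr : r.range.topologicalClosure = ⊤ := by
    refine ContinuousMap.starSubalgebra_topologicalClosure_eq_top_of_separatesPoints _ ?_
    intro φ ψ h
    obtain ⟨a, ha⟩ : ∃ a, φ.1.1 a ≠ ψ.1.1 a := by
      by_contra! h'
      exact h (Subtype.ext (isEmbedding_eval.injective (funext h')))
    exact ⟨_, ⟨r a, ⟨a, rfl⟩, rfl⟩, ha⟩
  have hmem : f.restrict K ∈ closure (r.range : Set C(K, ℂ)) := by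
    rw [← StarSubalgebra.topologicalClosure_coe, hr]
    trivial
  obtain ⟨_, ⟨a, rfl⟩, ha⟩ := Metric.mem_closure_iff.1 hmem ε hε
  refine ⟨a, fun φ hφ => ?_⟩
  rw [← dist_eq_norm, dist_comm]
  exact (ContinuousMap.dist_apply_le_dist (⟨φ, hφ⟩ : K)).trans_lt ha

end ContinuousCharacter

end Spectrum

/-! ### Gelfand duality for pro-C*-algebras -/

section ProCStar

open ContinuousCharacter

variable {A : Type u} [CommRing A] [StarRing A] [Algebra ℂ A] [StarModule ℂ A] [UniformSpace A]
  [UnitalProCStarAlgebra A]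

namespace UnitalProCStarAlgebra

theorem isTopologicalAddGroup (A : Type u) [CommRing A] [StarRing A] [Algebra ℂ A]
    [StarModule ℂ A] [UniformSpace A] [UnitalProCStarAlgebra A] : IsTopologicalAddGroup A :=
  (withSeminorms (A := A)).topologicalAddGroup

theorem continuousSMul (A : Type u) [CommRing A] [StarRing A] [Algebra ℂ A]
    [StarModule ℂ A] [UniformSpace A] [UnitalProCStarAlgebra A] : ContinuousSMul ℂ A :=
  (withSeminorms (A := A)).continuousSMul

theorem exists_ball_subset {U : Set A} (hU : U ∈ 𝓝 (0 : A)) :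
    ∃ p : Seminorm ℂ A, Continuous p ∧ IsCStarSeminorm p ∧ ∃ r > 0, ∀ a, p a < r → a ∈ U := by
  obtain ⟨s, r, hr, hs⟩ := (withSeminorms.mem_nhds_iff _ _).1 hU
  refine ⟨_, (IsCStarSeminorm.continuous_finset_sup s).1, (IsCStarSeminorm.continuous_finset_sup s).2, r, hr, fun a ha => hs ?_⟩
  rwa [Seminorm.mem_ball_zero]

theorem le_of_forall_dominated {p : Seminorm ℂ A} (hp : Continuous p) (hp' : IsCStarSeminorm p)
    {a : A} {ε : ℝ} (hε : 0 ≤ ε) (h : ∀ φ ∈ dominated p, ‖φ.1 a‖ ≤ ε) : p a ≤ ε := by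
  by_cases ha : p a = 0
  · rwa [ha]
  obtain ⟨φ, hφ, hφa⟩ := hp'.exists_character a ha
  have := isTopologicalAddGroup A
  have hc : Continuous φ := by
    refine continuous_of_continuousAt_zero φ ?_
    rw [ContinuousAt, map_zero]
    exact squeeze_zero_norm hφ (by simpa using hp.tendsto 0)
  rw [← hφa]
  exact h ⟨φ, hc⟩ hφ

theorem gelfand_injective : Function.Injective (gelfand (A := A)) := by
  rw [injective_iff_map_eq_zero]
  intro a ha
  have := t2Space (A := A)
  by_contra hne
  have := isTopologicalAddGroup A
  obtain ⟨p, hp, hp', r, hr, h⟩ := exists_ball_subset (isOpen_compl_singleton.mem_nhds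
    (show (0 : A) ∈ ({a} : Set A)ᶜ from Ne.symm hne))
  refine h a ?_ rfl
  refine (le_of_forall_dominated hp hp' le_rfl fun φ _ => ?_).trans_lt hr
  rw [← gelfand_apply, ha]
  simp

/-- The approximants of `f` on the sets `dominated p` generate a Cauchy filter, because `p` is
determined by its dominated characters. Its limit represents `f`, since every character is dominated
by some `p`. -/
theorem gelfand_surjective : Function.Surjective (gelfand (A := A)) := by
  intro f
  have := isTopologicalAddGroup A
  have := isUniformAddGroup (A := A)
  have := completeSpace (A := A)
  let ι := {p : Seminorm ℂ A // Continuous p ∧ IsCStarSeminorm p} × {ε : ℝ // 0 < ε}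
  let V : ι → Set A := fun i => {a | ∀ φ ∈ dominated i.1.1, ‖φ.1 a - f φ‖ < i.2.1}
  have hV (i : ι) : (V i).Nonempty :=
    exists_gelfand_near f (isCompact_dominated i.1.2.1) i.2.2
  let l : Filter A := ⨅ i, Filter.principal (V i)
  have : Nonempty ι := ⟨⟨⊥, continuous_const (y := (0 : ℝ)), .bot⟩, 1, one_pos⟩
  have hdir : Directed (· ≥ ·) fun i => Filter.principal (V i) := by
    rintro ⟨p, ε⟩ ⟨q, δ⟩
    refine ⟨⟨⟨p.1 ⊔ q.1, p.2.1.sup q.2.1, p.2.2.sup q.2.2⟩, ⟨min ε.1 δ.1, lt_min ε.2 δ.2⟩⟩, ?_, ?_⟩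
    · refine Filter.principal_mono.2 fun a ha φ hφ => ?_
      exact (ha φ fun b => (hφ b).trans (le_max_left _ _)).trans_le (min_le_left _ _)
    · refine Filter.principal_mono.2 fun a ha φ hφ => ?_
      exact (ha φ fun b => (hφ b).trans (le_max_right _ _)).trans_le (min_le_right _ _)
  have hl : l.NeBot := Filter.iInf_neBot_of_directed hdir fun i => Filter.principal_neBot_iff.2 (hV i)
  have hVl (i : ι) : V i ∈ l := Filter.mem_iInf_of_mem i (Filter.mem_principal_self _)
  have hcauchy : Cauchy l := by
    refine ⟨hl, ?_⟩
    rw [uniformity_eq_comap_nhds_zero, ← Filter.tendsto_iff_comap]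
    intro U hU
    obtain ⟨p, hp, hp', r, hr, h⟩ := exists_ball_subset hU
    let i : ι := ⟨⟨p, hp, hp'⟩, ⟨r / 4, by positivity⟩⟩
    rw [Filter.mem_map]
    refine Filter.mem_of_superset (Filter.prod_mem_prod (hVl i) (hVl i)) ?_
    rintro ⟨a, b⟩ ⟨ha, hb⟩
    refine h _ ?_
    refine (le_of_forall_dominated hp hp' (ε := r / 2) (by positivity) fun φ hφ => ?_).trans_lt
      (by linarith)
    have h1 := ha φ hφ
    have h2 := hb φ hφ
    have h3 : φ.1 (b - a) = (φ.1 b - f φ) - (φ.1 a - f φ) := by rw [map_sub]; ring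
    rw [h3]
    refine (norm_sub_le _ _).trans ?_
    change ‖φ.1 a - f φ‖ < r / 4 at h1
    change ‖φ.1 b - f φ‖ < r / 4 at h2
    linarith
  obtain ⟨a, ha⟩ := CompleteSpace.complete hcauchy
  refine ⟨a, ContinuousMap.ext fun φ => ?_⟩
  obtain ⟨p, hp, hp', hφ⟩ := exists_mem_dominated φ
  have h1 : Filter.Tendsto (fun b => φ.1 b) l (𝓝 (φ.1 a)) := (φ.2.tendsto a).mono_left ha
  refine tendsto_nhds_unique h1 (Metric.tendsto_nhds.2 fun ε hε => ?_)
  filter_upwards [hVl ⟨⟨p, hp, hp'⟩, ⟨ε, hε⟩⟩] with b hb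
  rw [dist_eq_norm]
  exact hb φ hφ

/-- The polar of `S` is absorbent because pseudocompactness bounds each `φ ↦ ‖φ a‖` on `S`; being a
barrel, it contains a ball of a continuous seminorm. -/
theorem exists_seminorm_bound (hA : IsBarreled A) {S : Set (ContinuousCharacter A)}
    (hS : IsRelativelyPseudocompact S) :
    ∃ p : Seminorm ℂ A, Continuous p ∧ S ⊆ dominated p := by
  have hB : IsBarrel {a : A | ∀ φ ∈ S, ‖φ.1 a‖ ≤ 1} := by
    refine ⟨?_, ?_, ?_, ?_⟩
    · intro a ha b hb s t hs ht hst φ hφ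
      rw [map_add, ← Complex.coe_smul s, ← Complex.coe_smul t, map_smul, map_smul]
      calc ‖(s : ℂ) • φ.1 a + (t : ℂ) • φ.1 b‖ ≤ s * ‖φ.1 a‖ + t * ‖φ.1 b‖ := by
            refine (norm_add_le _ _).trans_eq ?_
            rw [norm_smul, norm_smul, Complex.norm_of_nonneg hs, Complex.norm_of_nonneg ht]
        _ ≤ s * 1 + t * 1 := by
            gcongr
            exacts [ha φ hφ, hb φ hφ]
        _ = 1 := by rw [mul_one, mul_one, hst]
    · rw [balanced_iff_smul_mem]
      intro c hc a ha φ hφ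
      rw [map_smul, norm_smul]
      exact mul_le_one₀ hc (norm_nonneg _) (ha φ hφ)
    · refine absorbent_iff_eventually_nhdsNE_zero.2 fun a => ?_
      obtain ⟨M, hM⟩ := hS ⟨fun φ => ‖φ.1 a‖, (continuous_eval a).norm⟩
      have hlim : Filter.Tendsto (fun c : ℂ => ‖c‖ * M) (𝓝[≠] 0) (𝓝 0) :=
        ((continuous_norm.mul continuous_const).tendsto' 0 0 (by simp)).mono_left
          nhdsWithin_le_nhds
      filter_upwards [hlim.eventually_le_const one_pos] with c hc φ hφ
      rw [map_smul, norm_smul]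
      refine le_trans ?_ hc
      gcongr
      simpa using hM φ hφ
    · simp only [Set.ofPred_forall]
      exact isClosed_iInter fun φ => isClosed_iInter fun _ => isClosed_le φ.2.norm continuous_const
  obtain ⟨p, hp, -, r, hr, h⟩ := exists_ball_subset (hA _ hB)
  let c : NNReal := ⟨2 / r, by positivity⟩
  refine ⟨c • p, ?_, fun φ hφ a => ?_⟩
  · exact continuous_const.mul hp
  · change ‖φ.1 a‖ ≤ 2 / r * p a
    refine le_of_forall_pos_le_add fun ε hε => ?_
    have ht : 0 < p a + r / 2 * ε := add_pos_of_nonneg_of_pos (apply_nonneg p a) (by positivity)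
    have hpos : 0 < r / 2 / (p a + r / 2 * ε) := by positivity
    -- The factor scales `a` to seminorm at most `r / 2`, inside the open ball; the `ε` term covers
    -- `p a = 0`.
    have hmem := h (((r / 2 / (p a + r / 2 * ε) : ℝ) : ℂ) • a) ?_ φ hφ
    · rw [map_smul, norm_smul, Complex.norm_of_nonneg hpos.le, div_mul_eq_mul_div,
        div_le_one ht] at hmem
      have : ‖φ.1 a‖ ≤ 2 / r * (p a + r / 2 * ε) := by
        rw [div_mul_eq_mul_div, le_div_iff₀ hr]
        linarith
      refine this.trans_eq ?_
      field_simp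
    · rw [map_smul_eq_mul, Complex.norm_of_nonneg hpos.le, div_mul_eq_mul_div, div_lt_iff₀ ht]
      nlinarith [apply_nonneg p a, mul_pos hr (mul_pos hr hε)]

/-- Compact sets of characters are relatively pseudocompact, hence dominated by a continuous
seminorm; this gives continuity. For the inverse, each `p` is controlled on the compact set
`dominated p`. -/
theorem isHomeomorph_gelfand (hA : IsBarreled A) (e : A ≃⋆ₐ[ℂ] C(ContinuousCharacter A, ℂ))
    (he : ∀ a, e a = gelfand a) : IsHomeomorph e := by
  have := isTopologicalAddGroup A
  refine (Homeomorph.mk e.toEquiv ?_ ?_).isHomeomorph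
  · refine continuous_iff_continuousAt.2 fun a => ?_
    refine (ContinuousMap.hasBasis_nhds_norm_sub _).tendsto_right_iff.2 ?_
    rintro ⟨K, ε⟩ ⟨hK, hε⟩
    obtain ⟨p, hp, hKp⟩ := exists_seminorm_bound hA (S := K) fun f =>
      hK.exists_bound_of_continuousOn f.continuous.continuousOn
    have : Filter.Tendsto (fun b => p (b - a)) (𝓝 a) (𝓝 0) :=
      (hp.comp (continuous_id.sub continuous_const)).tendsto' _ _ (by simp)
    filter_upwards [this.eventually_lt_const hε] with b hb φ hφ
    change ‖e b φ - e a φ‖ < ε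
    rw [he, he, gelfand_apply, gelfand_apply, ← map_sub]
    exact (hKp hφ _).trans_lt hb
  · refine continuous_iff_continuousAt.2 fun f => ?_
    refine (withSeminorms.tendsto_nhds _ _).2 fun p ε hε => ?_
    have := (ContinuousMap.hasBasis_nhds_norm_sub f).mem_of_mem (i := (dominated p.1, ε / 2))
      ⟨isCompact_dominated p.2.1, half_pos hε⟩
    filter_upwards [this] with g hg
    refine (le_of_forall_dominated p.2.1 p.2.2 (ε := ε / 2) (by positivity) fun φ hφ => ?_).trans_lt
      (half_lt_self hε)
    have h1 (k : C(ContinuousCharacter A, ℂ)) : φ.1 (e.symm k) = k φ := by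
      rw [← gelfand_apply, ← he, StarAlgEquiv.apply_symm_apply]
    change ‖φ.1 (e.symm g - e.symm f)‖ ≤ ε / 2
    rw [map_sub, h1, h1]
    exact (hg φ hφ).le

end UnitalProCStarAlgebra

end ProCStar

open ContinuousCharacter UnitalProCStarAlgebra in
/-- Mathlib's topology on `C(X, ℂ)` is the compact-open topology; being of the form `C(X)` means being
*-isomorphic by a homeomorphism. -/
theorem mainTheorem8 (A : Type u) [CommRing A] [StarRing A] [Algebra ℂ A] [StarModule ℂ A]
    [UniformSpace A] [UnitalProCStarAlgebra A] :
    IsBarreled A ↔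
      ∃ (X : Type u) (_ : TopologicalSpace X),
        FunctionallyHausdorff X ∧
        (∀ S : Set X, IsRelativelyPseudocompact S → IsRelativelyCompact S) ∧
        ∃ e : A ≃⋆ₐ[ℂ] C(X, ℂ), IsHomeomorph e := by
  have := isTopologicalAddGroup A
  have := continuousSMul A
  constructor
  · intro hA
    refine ⟨ContinuousCharacter A, inferInstance, functionallyHausdorff, fun S hS => ?_,
      StarAlgEquiv.ofBijective gelfand ⟨gelfand_injective, gelfand_surjective⟩,
      isHomeomorph_gelfand hA _ fun a => rfl⟩
    obtain ⟨p, hp, hSp⟩ := exists_seminorm_bound hA hS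
    exact (isCompact_dominated hp).closure_of_subset hSp
  · rintro ⟨X, _, -, hX, e, he⟩
    rw [isBarreled_iff_barrelledSpace]
    have := ContinuousMap.barrelledSpace hX
    refine ⟨fun q hq => ?_⟩
    -- Barreledness is transported by pulling seminorms back along the inverse of `e`.
    let E : C(X, ℂ) →ₗ[ℂ] A :=
      { toFun := e.symm, map_add' := map_add e.symm, map_smul' := map_smul e.symm }
    have hE : Continuous E := by
      refine (he.homeomorph _).symm.continuous.congr fun f => ?_
      rw [Homeomorph.symm_apply_eq]
      exact (e.apply_symm_apply f).symm
    have hc : Continuous (q.comp E) := Seminorm.continuous_of_lowerSemicontinuous _ (hq.comp hE)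
    have : (q : A → ℝ) = (q.comp E) ∘ e := by
      ext a
      simp [E]
    rw [this]
    exact hc.comp he.continuous
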